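/- Let $K_1,K_2,H_1,H_2$ be complex Hilbert spaces and let $X\subseteq B(K_1,K_2)$ and $Y\subseteq B(H_1,H_2)$ be operator spaces, i.e. norm closed linear subspaces. Let $M_1\subseteq B(H_1,K_1)$ and $M_2\subseteq B(H_2,K_2)$ be ternary rings of operators (TROs), i.e. norm closed linear subspaces with $M_iM_i^*M_i\subseteq M_i$, and suppose that $X$ and $Y$ are strongly TRO equivalent via $M_1,M_2$, i.e. $$X=[M_2YM_1^*]\quad\text{and}\quad Y=[M_2^*XM_1],$$ where $[\,\cdot\,]$ denotes the norm closed linear span. Suppose that there are sequences $(m_i)_{i\in\mathbb N},(n_i)_{i\in\mathbb N}$ in $M_2$ and $(e_i)_{i\in\mathbb N},(f_i)_{i\in\mathbb N}$ in $M_1$ such that, for every $k$, the operators $$\sum_{i=1}^k m_im_i^*,\quad \sum_{i=1}^k n_i^*n_i,\quad \sum_{i=1}^k e_ie_i^*,\quad \sum_{i=1}^k f_i^*f_i$$ are contractions, and such that, in norm, $$\lim_k\sum_{i=1}^k m_im_i^*x=x,\qquad \lim_k x\sum_{i=1}^k e_ie_i^*=x\qquad\text{for all }x\in X,$$ $$\lim_k\sum_{i=1}^k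 n_i^*n_iy=y,\qquad \lim_k y\sum_{i=1}^k f_i^*f_i=y\qquad\text{for all }y\in Y.$$ Then $X$ and $Y$ are stably isomorphic: there is a surjective completely isometric linear map $K_\infty(X)\to K_\infty(Y)$. Here $K_\infty(X)\subseteq B(K_1^{(\infty)},K_2^{(\infty)})$ is the norm closure of the set of operators whose infinite matrix has all entries in $X$ and only finitely many nonzero entries, where $K^{(\infty)}$ is the Hilbert space direct sum of countably infinitely many copies of $K$; $K_\infty(Y)$ is defined likewise, and a linear map is completely isometric if for every $n$ it preserves the norms of $n\times n$ matrices, regarded as operators between the $n$-fold Hilbert space direct sums. -/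

import Mathlib

open Filter Topology ContinuousLinearMap

namespace OperatorSpace

section Concrete

variable {E F G H : Type*}
  [NormedAddCommGroup E] [InnerProductSpace ℂ E] [CompleteSpace E]
  [NormedAddCommGroup F] [InnerProductSpace ℂ F] [CompleteSpace F]
  [NormedAddCommGroup G] [InnerProductSpace ℂ G] [CompleteSpace G]
  [NormedAddCommGroup H] [InnerProductSpace ℂ H] [CompleteSpace H]

/-- A (concrete) operator space: a norm closed linear subspace of `B(E, F)`. -/
def IsOperatorSpace (X : Submodule ℂ (E →L[ℂ] F)) : Prop :=
  IsClosed (X : Set (E →L[ℂ] F))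

/-- A ternary ring of operators: an operator space `M ⊆ B(E, F)` with `M M* M ⊆ M`. -/
structure IsTRO (M : Submodule ℂ (E →L[ℂ] F)) : Prop where
  isOperatorSpace : IsOperatorSpace M
  mul_adjoint_mul_mem : ∀ a ∈ M, ∀ b ∈ M, ∀ c ∈ M, a ∘L adjoint b ∘L c ∈ M

/-- The closed linear span `[M Y N*]` of the products `m y n*`. -/
noncomputable def closedSpanMulMulAdjoint (M : Submodule ℂ (F →L[ℂ] H))
    (Y : Submodule ℂ (E →L[ℂ] F)) (N : Submodule ℂ (E →L[ℂ] G)) :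
    Submodule ℂ (G →L[ℂ] H) :=
  (Submodule.span ℂ
    {t | ∃ m ∈ M, ∃ y ∈ Y, ∃ n ∈ N, t = m ∘L y ∘L adjoint n}).topologicalClosure

/-- The closed linear span `[M* X N]` of the products `m* x n`. -/
noncomputable def closedSpanAdjointMulMul (M : Submodule ℂ (F →L[ℂ] H))
    (X : Submodule ℂ (G →L[ℂ] H)) (N : Submodule ℂ (E →L[ℂ] G)) :
    Submodule ℂ (E →L[ℂ] F) :=
  (Submodule.span ℂ
    {t | ∃ m ∈ M, ∃ x ∈ X, ∃ n ∈ N, t = adjoint m ∘L x ∘L n}).topologicalClosure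

/-- The operator spaces `X ⊆ B(G, H)` and `Y ⊆ B(E, F)` are strongly TRO equivalent via the
TROs `M₁ ⊆ B(E, G)` and `M₂ ⊆ B(F, H)`: `X = [M₂ Y M₁*]` and `Y = [M₂* X M₁]`. -/
structure StronglyTROEquivalentVia (X : Submodule ℂ (G →L[ℂ] H)) (Y : Submodule ℂ (E →L[ℂ] F))
    (M₁ : Submodule ℂ (E →L[ℂ] G)) (M₂ : Submodule ℂ (F →L[ℂ] H)) : Prop where
  isTRO_fst : IsTRO M₁
  isTRO_snd : IsTRO M₂
  left_eq : X = closedSpanMulMulAdjoint M₂ Y M₁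
  right_eq : Y = closedSpanAdjointMulMul M₂ X M₁

end Concrete

section Stable

variable {E F E' F' : Type*}
  [NormedAddCommGroup E] [InnerProductSpace ℂ E]
  [NormedAddCommGroup F] [InnerProductSpace ℂ F]
  [NormedAddCommGroup E'] [InnerProductSpace ℂ E']
  [NormedAddCommGroup F'] [InnerProductSpace ℂ F']

/-- The operator `Eⁿ → Fⁿ` between Hilbert space direct sums that is given by an `n × n` matrix of
operators `E → F`. Its operator norm is the norm of the matrix. -/
noncomputable def matrixOp {n : ℕ} (a : Fin n → Fin n → (E →L[ℂ] F)) :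
    PiLp 2 (fun _ : Fin n => E) →L[ℂ] PiLp 2 (fun _ : Fin n => F) :=
  (PiLp.continuousLinearEquiv 2 ℂ (fun _ : Fin n => F)).symm.toContinuousLinearMap ∘L
    ContinuousLinearMap.pi (fun i => ∑ j, a i j ∘L PiLp.proj 2 (fun _ : Fin n => E) j)

/-- Two operator spaces are completely isometrically isomorphic if there is a linear bijection
all of whose matrix amplifications are isometric. -/
def CompletelyIsometricallyIsomorphic (X : Submodule ℂ (E →L[ℂ] F))
    (Y : Submodule ℂ (E' →L[ℂ] F')) : Prop :=
  ∃ θ : X ≃ₗ[ℂ] Y, ∀ (n : ℕ) (a : Fin n → Fin n → X),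
    ‖matrixOp (fun i j => (θ (a i j) : E' →L[ℂ] F'))‖ =
      ‖matrixOp (fun i j => (a i j : E →L[ℂ] F))‖

/-- The countably infinite Hilbert space multiple `E^(∞)`. -/
abbrev Ampl (E : Type*) [NormedAddCommGroup E] : Type _ :=
  lp (fun _ : ℕ => E) 2

/-- The `(i, j)` entry of an operator `E^(∞) → F^(∞)` regarded as an infinite matrix. -/
noncomputable def entry (T : Ampl E →L[ℂ] Ampl F) (i j : ℕ) : E →L[ℂ] F :=
  lp.evalCLM ℂ (fun _ : ℕ => F) 2 i ∘L T ∘L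
    lp.singleContinuousLinearMap ℂ (fun _ : ℕ => E) 2 j

/-- `M_∞(X)`: the bounded operators `E^(∞) → F^(∞)` all of whose matrix entries lie in `X`. -/
noncomputable def MInfty (X : Submodule ℂ (E →L[ℂ] F)) :
    Submodule ℂ (Ampl E →L[ℂ] Ampl F) where
  carrier := {T | ∀ i j, entry T i j ∈ X}
  zero_mem' := fun i j => by simp [entry]
  add_mem' := fun {S T} hS hT i j => by
    have h : entry (S + T) i j = entry S i j + entry T i j := by
      simp [entry, ContinuousLinearMap.add_comp, ContinuousLinearMap.comp_add]
    rw [h]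
    exact X.add_mem (hS i j) (hT i j)
  smul_mem' := fun c T hT i j => by
    have h : entry (c • T) i j = c • entry T i j := by
      simp [entry, ContinuousLinearMap.smul_comp, ContinuousLinearMap.comp_smul]
    rw [h]
    exact X.smul_mem c (hT i j)

/-- The elements of `M_∞(X)` with only finitely many nonzero matrix entries. -/
noncomputable def finMInfty (X : Submodule ℂ (E →L[ℂ] F)) :
    Submodule ℂ (Ampl E →L[ℂ] Ampl F) where
  carrier := {T | T ∈ MInfty X ∧ ∃ N : ℕ, ∀ i j, N ≤ i ∨ N ≤ j → entry T i j = 0}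
  zero_mem' := ⟨(MInfty X).zero_mem, 0, fun i j _ => by simp [entry]⟩
  add_mem' := by
    rintro S T ⟨hS, N, hN⟩ ⟨hT, N', hN'⟩
    refine ⟨(MInfty X).add_mem hS hT, max N N', fun i j hij => ?_⟩
    have h : entry (S + T) i j = entry S i j + entry T i j := by
      simp [entry, ContinuousLinearMap.add_comp, ContinuousLinearMap.comp_add]
    rw [h, hN i j (by omega), hN' i j (by omega), add_zero]
  smul_mem' := by
    rintro c T ⟨hT, N, hN⟩
    refine ⟨(MInfty X).smul_mem c hT, N, fun i j hij => ?_⟩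
    have h : entry (c • T) i j = c • entry T i j := by
      simp [entry, ContinuousLinearMap.smul_comp, ContinuousLinearMap.comp_smul]
    rw [h, hN i j hij, smul_zero]

/-- `K_∞(X)`: the norm closure of the finitely supported matrices in `M_∞(X)`. -/
noncomputable def KInfty (X : Submodule ℂ (E →L[ℂ] F)) :
    Submodule ℂ (Ampl E →L[ℂ] Ampl F) :=
  (finMInfty X).topologicalClosure

/-- `X` and `Y` are stably isomorphic: `K_∞(X)` and `K_∞(Y)` are completely isometrically
isomorphic. -/
def StablyIsomorphic (X : Submodule ℂ (E →L[ℂ] F)) (Y : Submodule ℂ (E' →L[ℂ] F')) : Prop :=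
  CompletelyIsometricallyIsomorphic (KInfty X) (KInfty Y)

end Stable

end OperatorSpace

/-! The proof inserts an intermediate space `Z` of operators `K₁ → H₂`, the `linkingSpace`, which
contains `M₂* X` and `Y M₁*`, and shows `K_∞(X) ≅ K_∞(Z) ≅ K_∞(Y)`. The first isomorphism is left
multiplication by an operator that acts as a unitary. The second is the same statement for the
adjoint spaces, with `e`, `f` in place of `m`, `n`.

For `K_∞(X) ≅ K_∞(Z)`, the infinite ampliation of the column `(m i)*` acts on `K_∞(X)` as an
isometry into `K_∞(Z)`, because the sums of `m i (m i)*` converge to the identity on `X`. The column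
`n i` gives an isometry back (`isIsometricMultiplier_columnAmpl`). Splitting `ℕ` into evens and odds
gives `K_∞(X) ≅ K_∞(X) ⊕ K_∞(X)` as columns, and likewise for `Z`. Each space therefore absorbs the
other (`exists_absorbing`), and `K_∞(Z) ≅ K_∞(X) ⊕ K_∞(Z) ≅ K_∞(X)` (`exists_unitary`).

All isometry relations are required only on vectors `x v` with `x` in the operator space, since the
approximate units say nothing about the rest of the Hilbert spaces. Left multiplication by such a
unitary preserves all matrix norms (`completelyIsometricallyIsomorphic`). -/

namespace OperatorSpace

/-! ### Matrix units and generators of `K_∞(X)`. -/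

section MatrixUnits

variable {E F G : Type*}
  [NormedAddCommGroup E] [InnerProductSpace ℂ E]
  [NormedAddCommGroup F] [InnerProductSpace ℂ F]
  [NormedAddCommGroup G] [InnerProductSpace ℂ G]

/-- The inclusion of `E` as the `i`-th summand of `E^(∞)`. -/
noncomputable abbrev inclusion (E : Type*) [NormedAddCommGroup E] [InnerProductSpace ℂ E] (i : ℕ) :
    E →L[ℂ] Ampl E :=
  lp.singleContinuousLinearMap ℂ (fun _ : ℕ => E) 2 i

/-- The coordinate map of `E^(∞)` onto the `i`-th summand. -/
noncomputable abbrev coord (E : Type*) [NormedAddCommGroup E] [InnerProductSpace ℂ E] (i : ℕ) :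
    Ampl E →L[ℂ] E :=
  lp.evalCLM ℂ (fun _ : ℕ => E) 2 i

/-- The operator whose infinite matrix has the single entry `x` in position `(i, j)`. -/
noncomputable def matrixUnit (i j : ℕ) (x : E →L[ℂ] F) : Ampl E →L[ℂ] Ampl F :=
  inclusion F i ∘L x ∘L coord E j

theorem coord_apply (i : ℕ) (v : Ampl E) : coord E i v = v i := rfl

theorem inclusion_apply (i j : ℕ) (v : E) : (inclusion E i v) j = if j = i then v else 0 := by
  rw [lp.singleContinuousLinearMap_apply, lp.single_apply, Pi.single_apply]

theorem ampl_hom_ext {S T : Ampl E →L[ℂ] G} (h : ∀ j, S ∘L inclusion E j = T ∘L inclusion E j) :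
    S = T :=
  lp.ext_continuousLinearMap (by simp) h

theorem entry_matrixUnit (i j k l : ℕ) (x : E →L[ℂ] F) :
    entry (matrixUnit i j x) k l = if k = i ∧ l = j then x else 0 := by
  ext v
  change (inclusion F i (x ((inclusion E l v) j))) k = _
  rw [inclusion_apply, inclusion_apply]
  by_cases h : k = i <;> by_cases h' : l = j <;> simp [h, h', @eq_comm _ j l]

theorem matrixUnit_mem_finMInfty {X : Submodule ℂ (E →L[ℂ] F)} {x : E →L[ℂ] F} (hx : x ∈ X)
    (i j : ℕ) : matrixUnit i j x ∈ finMInfty X := by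
  refine ⟨fun k l => ?_, max i j + 1, fun k l hkl => ?_⟩
  · rw [entry_matrixUnit]
    split_ifs
    exacts [hx, X.zero_mem]
  · rw [entry_matrixUnit, if_neg (by omega)]

theorem matrixUnit_mem_KInfty {X : Submodule ℂ (E →L[ℂ] F)} {x : E →L[ℂ] F} (hx : x ∈ X)
    (i j : ℕ) : matrixUnit i j x ∈ KInfty X :=
  Submodule.le_topologicalClosure _ (matrixUnit_mem_finMInfty hx i j)

theorem sum_matrixUnit_entry {T : Ampl E →L[ℂ] Ampl F} {N : ℕ}
    (hN : ∀ i j, N ≤ i ∨ N ≤ j → entry T i j = 0) :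
    ∑ i ∈ Finset.range N, ∑ j ∈ Finset.range N, matrixUnit i j (entry T i j) = T := by
  refine ampl_hom_ext fun l => ?_
  ext v k
  change _ = entry T k l v
  simp only [ContinuousLinearMap.comp_apply, _root_.sum_apply]
  rw [← coord_apply, map_sum]
  simp only [map_sum]
  have h : ∀ i j, coord F k (matrixUnit i j (entry T i j) (inclusion E l v)) =
      if k = i then if l = j then entry T i j v else 0 else 0 := fun i j => by
    change entry (matrixUnit i j (entry T i j)) k l v = _
    rw [entry_matrixUnit]
    by_cases h : k = i <;> by_cases h' : l = j <;> simp [h, h']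
  simp only [h, Finset.sum_ite_irrel, Finset.sum_const_zero, Finset.sum_ite_eq, Finset.mem_range]
  split_ifs with h₁ h₂
  · rfl
  · rw [hN k l (by omega)]; rfl
  · rw [hN k l (by omega)]; rfl

/-- `K_∞(X)` is the closed linear span of the matrix units with coefficient in `X`. -/
theorem KInfty_le {X : Submodule ℂ (E →L[ℂ] F)} {P : Submodule ℂ (Ampl E →L[ℂ] Ampl F)}
    (hP : IsClosed (P : Set (Ampl E →L[ℂ] Ampl F)))
    (h : ∀ i j, ∀ x ∈ X, matrixUnit i j x ∈ P) : KInfty X ≤ P := by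
  refine Submodule.topologicalClosure_minimal _ ?_ hP
  rintro T ⟨hT, N, hN⟩
  rw [← sum_matrixUnit_entry hN]
  exact P.sum_mem fun i _ => P.sum_mem fun j _ => h i j _ (hT i j)

theorem isClosed_KInfty (X : Submodule ℂ (E →L[ℂ] F)) :
    IsClosed (KInfty X : Set (Ampl E →L[ℂ] Ampl F)) :=
  Submodule.isClosed_topologicalClosure _

/-- Left multiplication by `S` is continuous and linear, so the preimage of `K_∞(Z)` is a closed
subspace and only matrix units need checking. -/
theorem comp_mem_KInfty {X : Submodule ℂ (E →L[ℂ] F)} {Z : Submodule ℂ (E →L[ℂ] G)}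
    {S : Ampl F →L[ℂ] Ampl G} (h : ∀ i j, ∀ x ∈ X, S ∘L matrixUnit i j x ∈ KInfty Z)
    {T : Ampl E →L[ℂ] Ampl F} (hT : T ∈ KInfty X) : S ∘L T ∈ KInfty Z := by
  have := KInfty_le (P := (KInfty Z).comap (compL ℂ (Ampl E) _ _ S).toLinearMap)
    ((isClosed_KInfty Z).preimage (compL ℂ (Ampl E) _ _ S).continuous) h
  exact this hT

theorem comp_eq_self_of_mem_KInfty {X : Submodule ℂ (E →L[ℂ] F)} {S : Ampl F →L[ℂ] Ampl F}
    (h : ∀ i j, ∀ x ∈ X, S ∘L matrixUnit i j x = matrixUnit i j x)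
    {T : Ampl E →L[ℂ] Ampl F} (hT : T ∈ KInfty X) : S ∘L T = T := by
  have := KInfty_le (P := LinearMap.eqLocus (compL ℂ (Ampl E) _ _ S).toLinearMap LinearMap.id)
    (isClosed_eq (compL ℂ (Ampl E) _ _ S).continuous continuous_id) h
  exact this hT

theorem comp_matrixUnit (x : E →L[ℂ] F) (y : F →L[ℂ] G) (S : Ampl F →L[ℂ] Ampl G) (i j k : ℕ)
    (h : S ∘L inclusion F i = inclusion G k ∘L y) :
    S ∘L matrixUnit i j x = matrixUnit k j (y ∘L x) := by
  simp only [matrixUnit, ← ContinuousLinearMap.comp_assoc, h]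

end MatrixUnits

/-! ### Adjoint spaces and their compatibility with `K_∞`. -/

section Adjoint

variable {E F : Type*}
  [NormedAddCommGroup E] [InnerProductSpace ℂ E] [CompleteSpace E]
  [NormedAddCommGroup F] [InnerProductSpace ℂ F] [CompleteSpace F]

theorem adjoint_inclusion (i : ℕ) : adjoint (inclusion E i) = coord E i := by
  symm
  rw [ContinuousLinearMap.eq_adjoint_iff]
  intro v w
  rw [coord_apply, lp.singleContinuousLinearMap_apply, lp.inner_single_right]

theorem adjoint_coord (i : ℕ) : adjoint (coord E i) = inclusion E i := by
  rw [← adjoint_inclusion, ContinuousLinearMap.adjoint_adjoint]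

theorem adjoint_matrixUnit (i j : ℕ) (x : E →L[ℂ] F) :
    adjoint (matrixUnit i j x) = matrixUnit j i (adjoint x) := by
  simp only [matrixUnit, ContinuousLinearMap.adjoint_comp, adjoint_inclusion, adjoint_coord,
    ContinuousLinearMap.comp_assoc]

/-- The operator space `X*` of the adjoints of the elements of `X`. -/
noncomputable def adjointSpace (X : Submodule ℂ (E →L[ℂ] F)) : Submodule ℂ (F →L[ℂ] E) where
  carrier := {T | adjoint T ∈ X}
  zero_mem' := by simp
  add_mem' := fun {S T} hS hT => by
    simp only [Set.mem_ofPred_eq, map_add] at *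
    exact X.add_mem hS hT
  smul_mem' := fun c T hT => by
    simp only [Set.mem_ofPred_eq, map_smulₛₗ] at *
    exact X.smul_mem _ hT

theorem mem_adjointSpace {X : Submodule ℂ (E →L[ℂ] F)} {T : F →L[ℂ] E} :
    T ∈ adjointSpace X ↔ adjoint T ∈ X := Iff.rfl

theorem adjointSpace_adjointSpace (X : Submodule ℂ (E →L[ℂ] F)) :
    adjointSpace (adjointSpace X) = X := by
  ext T
  simp [mem_adjointSpace]

theorem isClosed_adjointSpace {X : Submodule ℂ (E →L[ℂ] F)}
    (hX : IsClosed (X : Set (E →L[ℂ] F))) : IsClosed (adjointSpace X : Set (F →L[ℂ] E)) :=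
  hX.preimage (adjoint (𝕜 := ℂ) (E := F) (F := E)).continuous

theorem KInfty_adjointSpace_le (X : Submodule ℂ (E →L[ℂ] F)) :
    KInfty (adjointSpace X) ≤ adjointSpace (KInfty X) := by
  refine KInfty_le (isClosed_adjointSpace (isClosed_KInfty X)) fun i j x hx => ?_
  rw [mem_adjointSpace, adjoint_matrixUnit]
  exact matrixUnit_mem_KInfty (mem_adjointSpace.1 hx) j i

/-- Generators give one inclusion; the other is that inclusion for `X*`, because the adjoint is an
involution. -/
theorem mem_KInfty_adjointSpace {X : Submodule ℂ (E →L[ℂ] F)} {T : Ampl F →L[ℂ] Ampl E} :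
    T ∈ KInfty (adjointSpace X) ↔ adjoint T ∈ KInfty X := by
  refine ⟨fun h => KInfty_adjointSpace_le X h, fun h => ?_⟩
  rw [← adjointSpace_adjointSpace X] at h
  have := KInfty_adjointSpace_le _ h
  rwa [mem_adjointSpace, ContinuousLinearMap.adjoint_adjoint] at this

theorem adjointSpace_KInfty_adjointSpace (X : Submodule ℂ (E →L[ℂ] F)) :
    adjointSpace (KInfty (adjointSpace X)) = KInfty X := by
  ext T
  rw [mem_adjointSpace, mem_KInfty_adjointSpace, ContinuousLinearMap.adjoint_adjoint]

end Adjoint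

/-! ### Contractions with one nonzero entry per row. -/

section Monomial

variable {E F : Type*}
  [NormedAddCommGroup E] [InnerProductSpace ℂ E]
  [NormedAddCommGroup F] [InnerProductSpace ℂ F]

/-- The fibrewise column condition that makes `v ↦ (a p (v (τ p)))` a contraction. -/
def IsColumnContraction (τ : ℕ → ℕ) (a : ℕ → (E →L[ℂ] F)) : Prop :=
  ∀ (j : ℕ) (s : Finset ℕ), (∀ p ∈ s, τ p = j) → ∀ v : E, ∑ p ∈ s, ‖a p v‖ ^ 2 ≤ ‖v‖ ^ 2

theorem sum_norm_sq_le {E : Type*} [NormedAddCommGroup E] (v : Ampl E) (s : Finset ℕ) : ∑ i ∈ s, ‖v i‖ ^ 2 ≤ ‖v‖ ^ 2 := by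
  simpa using lp.sum_rpow_le_norm_rpow (p := 2) (by simp) v s

theorem IsColumnContraction.sum_le {τ : ℕ → ℕ} {a : ℕ → (E →L[ℂ] F)}
    (h : IsColumnContraction τ a) (v : Ampl E) (s : Finset ℕ) :
    ∑ p ∈ s, ‖a p (v (τ p))‖ ^ 2 ≤ ‖v‖ ^ 2 := by
  rw [← Finset.sum_fiberwise_of_maps_to (t := s.image τ) (g := τ)
    fun p hp => Finset.mem_image_of_mem τ hp]
  refine le_trans (Finset.sum_le_sum fun j _ => ?_) (sum_norm_sq_le v (s.image τ))
  calc ∑ p ∈ s with τ p = j, ‖a p (v (τ p))‖ ^ 2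
      = ∑ p ∈ s with τ p = j, ‖a p (v j)‖ ^ 2 :=
        Finset.sum_congr rfl fun p hp => by rw [(Finset.mem_filter.1 hp).2]
    _ ≤ ‖v j‖ ^ 2 := h j _ (fun p hp => (Finset.mem_filter.1 hp).2) _

/-- The contraction `E^(∞) → F^(∞)` that sends `v` to `(a p (v (τ p)))`. -/
noncomputable def rowMonomial (τ : ℕ → ℕ) (a : ℕ → (E →L[ℂ] F)) (h : IsColumnContraction τ a) :
    Ampl E →L[ℂ] Ampl F :=
  LinearMap.mkContinuous
    { toFun := fun v => ⟨fun p => a p (v (τ p)),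
        memℓp_gen' (C := ‖v‖ ^ 2) fun s => by simpa using h.sum_le v s⟩
      map_add' := fun v w => by ext p; exact map_add (a p) _ _
      map_smul' := fun c v => by ext p; exact map_smul (a p) _ _ }
    1 fun v => lp.norm_le_of_forall_sum_le (by simp) (by positivity) fun s => by
      simpa using h.sum_le v s

variable {τ : ℕ → ℕ} {a : ℕ → (E →L[ℂ] F)} (h : IsColumnContraction τ a)

theorem rowMonomial_apply (v : Ampl E) (p : ℕ) : rowMonomial τ a h v p = a p (v (τ p)) := rfl

theorem norm_rowMonomial_apply_le (v : Ampl E) : ‖rowMonomial τ a h v‖ ≤ ‖v‖ := by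
  refine lp.norm_le_of_forall_sum_le (by simp) (by positivity) fun s => ?_
  simpa [rowMonomial_apply] using h.sum_le v s

/-- Row `p` has its only entry in column `τ p`, so the adjoint carries one summand into one summand
and sends matrix units to matrix units. The operator itself may spread a summand over infinitely
many, which is why it needs a limit argument later. -/
theorem adjoint_rowMonomial_comp_inclusion [CompleteSpace E] [CompleteSpace F] (p : ℕ) :
    adjoint (rowMonomial τ a h) ∘L inclusion F p = inclusion E (τ p) ∘L adjoint (a p) := by
  ext1 w
  refine ext_inner_right ℂ fun v => ?_
  simp only [ContinuousLinearMap.comp_apply, ContinuousLinearMap.adjoint_inner_left,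
    lp.singleContinuousLinearMap_apply, lp.inner_single_left, rowMonomial_apply]

end Monomial

/-! ### The even–odd splitting of `E^(∞)`. -/

section Splitting

variable (E : Type*) [NormedAddCommGroup E] [InnerProductSpace ℂ E]

/-- The fibre of `p ↦ p / 2` over `j` contains at most one index of parity `r`, namely `2 * j + r`.
-/
theorem isColumnContraction_parity (r : ℕ) : IsColumnContraction (fun p => p / 2)
    (fun p => if p % 2 = r then ContinuousLinearMap.id ℂ E else 0) := by
  intro j s hs v
  calc _ ≤ ∑ p ∈ s, if p = 2 * j + r then ‖v‖ ^ 2 else 0 := by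
        refine Finset.sum_le_sum fun p hp => ?_
        have := hs p hp
        dsimp only at this ⊢
        by_cases hr : p % 2 = r
        · rw [if_pos hr, if_pos (by omega)]; rfl
        · rw [if_neg hr]
          split_ifs <;> simp
    _ ≤ ‖v‖ ^ 2 := by
        rw [Finset.sum_ite_eq']
        split_ifs
        exacts [le_rfl, by positivity]

/-- The isometry of `E^(∞)` that moves the `j`-th summand to the summand `2 j + r`. -/
noncomputable def spread (r : ℕ) : Ampl E →L[ℂ] Ampl E :=
  rowMonomial _ _ (isColumnContraction_parity E r)

variable {E}

theorem spread_comp_inclusion {r : ℕ} (hr : r < 2) (j : ℕ) :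
    spread E r ∘L inclusion E j = inclusion E (2 * j + r) := by
  ext v p
  rw [ContinuousLinearMap.comp_apply, spread, rowMonomial_apply, inclusion_apply, inclusion_apply]
  by_cases h : p % 2 = r
  · rw [if_pos h, ContinuousLinearMap.id_apply]
    exact if_congr (by omega) rfl rfl
  · rw [if_neg h, _root_.zero_apply, if_neg (by omega)]

variable [CompleteSpace E]

theorem adjoint_spread_comp_inclusion (r p : ℕ) :
    adjoint (spread E r) ∘L inclusion E p = if p % 2 = r then inclusion E (p / 2) else 0 := by
  rw [spread, adjoint_rowMonomial_comp_inclusion]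
  split_ifs
  · rw [← ContinuousLinearMap.one_def, ← ContinuousLinearMap.star_eq_adjoint, star_one]; rfl
  · simp

theorem adjoint_spread_apply_spread_self {r : ℕ} (hr : r < 2) (v : Ampl E) :
    adjoint (spread E r) (spread E r v) = v := by
  refine DFunLike.congr_fun (f := adjoint (spread E r) ∘L spread E r)
    (g := ContinuousLinearMap.id ℂ _) (ampl_hom_ext fun j => ?_) v
  rw [ContinuousLinearMap.comp_assoc, spread_comp_inclusion hr, adjoint_spread_comp_inclusion,
    if_pos (by omega), ContinuousLinearMap.id_comp]
  congr 1
  omega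

theorem adjoint_spread_apply_spread_of_ne {r r' : ℕ} (hr : r < 2) (h : r ≠ r') (v : Ampl E) :
    adjoint (spread E r') (spread E r v) = 0 := by
  refine DFunLike.congr_fun (f := adjoint (spread E r') ∘L spread E r)
    (g := 0) (ampl_hom_ext fun j => ?_) v
  rw [ContinuousLinearMap.comp_assoc, spread_comp_inclusion hr, adjoint_spread_comp_inclusion,
    if_neg (by omega), ContinuousLinearMap.zero_comp]

theorem spread_apply_adjoint_spread_add (v : Ampl E) :
    spread E 0 (adjoint (spread E 0) v) + spread E 1 (adjoint (spread E 1) v) = v := by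
  refine DFunLike.congr_fun
    (f := spread E 0 ∘L adjoint (spread E 0) + spread E 1 ∘L adjoint (spread E 1))
    (g := ContinuousLinearMap.id ℂ _) (ampl_hom_ext fun p => ?_) v
  rw [ContinuousLinearMap.add_comp, ContinuousLinearMap.comp_assoc, ContinuousLinearMap.comp_assoc,
    adjoint_spread_comp_inclusion, adjoint_spread_comp_inclusion, ContinuousLinearMap.id_comp]
  rcases Nat.mod_two_eq_zero_or_one p with hp | hp
  · rw [if_pos hp, if_neg (by omega), spread_comp_inclusion (by omega), ContinuousLinearMap.comp_zero,
      add_zero]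
    congr 1
    omega
  · rw [if_pos hp, if_neg (by omega), spread_comp_inclusion (by omega), ContinuousLinearMap.comp_zero,
      zero_add]
    congr 1
    omega

end Splitting

/-! ### Multipliers, absorption and the decomposition argument. -/

section Multiplier

variable {G A B C : Type*}
  [NormedAddCommGroup G] [InnerProductSpace ℂ G]
  [NormedAddCommGroup A] [InnerProductSpace ℂ A] [CompleteSpace A]
  [NormedAddCommGroup B] [InnerProductSpace ℂ B] [CompleteSpace B]
  [NormedAddCommGroup C] [InnerProductSpace ℂ C] [CompleteSpace C]

/-- `S` is an adjointable left multiplier from `𝒳` to `𝒵`: `S 𝒳 ⊆ 𝒵` and `S* 𝒵 ⊆ 𝒳`. -/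
structure IsMultiplier (𝒳 : Submodule ℂ (G →L[ℂ] A)) (𝒵 : Submodule ℂ (G →L[ℂ] B))
    (S : A →L[ℂ] B) : Prop where
  comp_mem : ∀ x ∈ 𝒳, S ∘L x ∈ 𝒵
  adjoint_comp_mem : ∀ z ∈ 𝒵, adjoint S ∘L z ∈ 𝒳

namespace IsMultiplier

variable {𝒳 : Submodule ℂ (G →L[ℂ] A)} {𝒵 : Submodule ℂ (G →L[ℂ] B)}
  {𝒲 : Submodule ℂ (G →L[ℂ] C)}

theorem adjoint {S : A →L[ℂ] B} (h : IsMultiplier 𝒳 𝒵 S) :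
    IsMultiplier 𝒵 𝒳 (ContinuousLinearMap.adjoint S) :=
  ⟨h.2, by simpa using h.1⟩

theorem comp {S : A →L[ℂ] B} {T : B →L[ℂ] C} (hT : IsMultiplier 𝒵 𝒲 T)
    (hS : IsMultiplier 𝒳 𝒵 S) : IsMultiplier 𝒳 𝒲 (T ∘L S) :=
  ⟨fun x hx => hT.1 _ (hS.1 x hx), fun w hw => by
    rw [ContinuousLinearMap.adjoint_comp, ContinuousLinearMap.comp_assoc]; exact hS.2 _ (hT.2 w hw)⟩

theorem add {S T : A →L[ℂ] B} (hS : IsMultiplier 𝒳 𝒵 S) (hT : IsMultiplier 𝒳 𝒵 T) :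
    IsMultiplier 𝒳 𝒵 (S + T) :=
  ⟨fun x hx => by
    rw [ContinuousLinearMap.add_comp]; exact 𝒵.add_mem (hS.1 x hx) (hT.1 x hx), fun z hz => by
    rw [map_add, ContinuousLinearMap.add_comp]; exact 𝒳.add_mem (hS.2 z hz) (hT.2 z hz)⟩

theorem sub {S T : A →L[ℂ] B} (hS : IsMultiplier 𝒳 𝒵 S) (hT : IsMultiplier 𝒳 𝒵 T) :
    IsMultiplier 𝒳 𝒵 (S - T) :=
  ⟨fun x hx => by
    rw [ContinuousLinearMap.sub_comp]; exact 𝒵.sub_mem (hS.1 x hx) (hT.1 x hx), fun z hz => by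
    rw [map_sub, ContinuousLinearMap.sub_comp]; exact 𝒳.sub_mem (hS.2 z hz) (hT.2 z hz)⟩

theorem id (𝒳 : Submodule ℂ (G →L[ℂ] A)) : IsMultiplier 𝒳 𝒳 (ContinuousLinearMap.id ℂ A) :=
  ⟨fun x hx => hx, fun x hx => by rwa [ContinuousLinearMap.adjoint_id]⟩

end IsMultiplier

/-- `S` acts as an isometry from `𝒳` to `𝒵`: it is a multiplier, and `S* S` is the identity
on `𝒳`. -/
structure IsIsometricMultiplier (𝒳 : Submodule ℂ (G →L[ℂ] A)) (𝒵 : Submodule ℂ (G →L[ℂ] B))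
    (S : A →L[ℂ] B) : Prop extends IsMultiplier 𝒳 𝒵 S where
  adjoint_apply_apply : ∀ x ∈ 𝒳, ∀ v, adjoint S (S (x v)) = x v

variable {𝒳 : Submodule ℂ (G →L[ℂ] A)} {𝒵 : Submodule ℂ (G →L[ℂ] B)}

/-- An isometric multiplier `T : 𝒳 → 𝒵` and a decomposition `𝒳 ≅ 𝒳 ⊕ 𝒳` give a decomposition
`𝒵 ≅ 𝒳 ⊕ 𝒵`. -/
theorem IsIsometricMultiplier.exists_absorbing {T : A →L[ℂ] B}
    (hT : IsIsometricMultiplier 𝒳 𝒵 T) {P Q : A →L[ℂ] A}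
    (hP : IsIsometricMultiplier 𝒳 𝒳 P) (hQ : IsIsometricMultiplier 𝒳 𝒳 Q)
    (hPQ : ∀ x ∈ 𝒳, ∀ v, adjoint P (Q (x v)) = 0)
    (hadd : ∀ x ∈ 𝒳, ∀ v, P (adjoint P (x v)) + Q (adjoint Q (x v)) = x v) :
    ∃ (R : A →L[ℂ] B) (S : B →L[ℂ] B),
      IsIsometricMultiplier 𝒳 𝒵 R ∧ IsIsometricMultiplier 𝒵 𝒵 S ∧
      (∀ z ∈ 𝒵, ∀ v, adjoint R (S (z v)) = 0) ∧
      (∀ x ∈ 𝒳, ∀ v, adjoint S (R (x v)) = 0) ∧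
      ∀ z ∈ 𝒵, ∀ v, R (adjoint R (z v)) + S (adjoint S (z v)) = z v := by
  -- Apply `P P* + Q Q* = 1` to `P x`: since `P* P x = x`, this leaves `Q Q* P x = 0`, and `Q*` then
  -- cancels `Q`.
  have hQP : ∀ x ∈ 𝒳, ∀ v, adjoint Q (P (x v)) = 0 := fun x hx v => by
    have h := hadd _ (hP.comp_mem x hx) v
    rw [ContinuousLinearMap.comp_apply, hP.adjoint_apply_apply x hx, add_eq_left] at h
    have h' := hQ.adjoint_apply_apply _ (hQ.adjoint_comp_mem _ (hP.comp_mem x hx)) v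
    simp only [ContinuousLinearMap.comp_apply] at h'
    rw [← h', h, map_zero]
  -- `S` is the identity off the range of `T` and a copy of `Q` on that range. With `R = T P`, the
  -- range of `T` is split into its `P` half, taken by `R`, and its `Q` half, kept by `S`.
  have hS : IsMultiplier 𝒵 𝒵
      (ContinuousLinearMap.id ℂ B - T ∘L adjoint T + T ∘L Q ∘L adjoint T) :=
    ((IsMultiplier.id 𝒵).sub (hT.comp hT.adjoint)).add
      (hT.comp (hQ.comp hT.adjoint))
  have hSa : adjoint (ContinuousLinearMap.id ℂ B - T ∘L adjoint T + T ∘L Q ∘L adjoint T) =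
      ContinuousLinearMap.id ℂ B - T ∘L adjoint T + T ∘L adjoint Q ∘L adjoint T := by
    simp [ContinuousLinearMap.adjoint_comp, ContinuousLinearMap.adjoint_id,
      ContinuousLinearMap.comp_assoc]
  have hRm := hT.comp hP.toIsMultiplier
  -- `T* T` need not be the identity on all of `A`, so every cancellation below carries a proof that
  -- the operator it is applied to lies in `𝒳`.
  have tt : ∀ x ∈ 𝒳, ∀ v, adjoint T (T (x v)) = x v := hT.adjoint_apply_apply
  refine ⟨T ∘L P, _, ⟨hRm, fun x hx v => ?_⟩, ⟨hS, fun z hz v => ?_⟩, fun z hz v => ?_,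
    fun x hx v => ?_, fun z hz v => ?_⟩
  · have h₁ := tt _ (hP.comp_mem x hx) v
    have h₂ := hP.adjoint_apply_apply x hx v
    simp only [ContinuousLinearMap.adjoint_comp, ContinuousLinearMap.comp_apply] at *
    rw [h₁, h₂]
  · have hz' := hT.adjoint_comp_mem z hz
    have h₁ := tt _ hz' v
    have h₂ := tt _ (hQ.comp_mem _ hz') v
    have h₃ := hQ.adjoint_apply_apply _ hz' v
    rw [hSa]
    simp only [ContinuousLinearMap.comp_apply, _root_.add_apply,
      _root_.sub_apply, ContinuousLinearMap.id_apply, map_add, map_sub] at *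
    simp only [h₁, h₂, h₃]
    simp
  · have hz' := hT.adjoint_comp_mem z hz
    have h₁ := tt _ hz' v
    have h₂ := tt _ (hQ.comp_mem _ hz') v
    have h₃ := hPQ _ hz' v
    simp only [ContinuousLinearMap.adjoint_comp, ContinuousLinearMap.comp_apply,
      _root_.add_apply,
      _root_.sub_apply, ContinuousLinearMap.id_apply, map_add, map_sub] at *
    simp only [h₁, h₂, h₃]
    simp
  · have h₁ := tt _ (hP.comp_mem x hx) v
    have h₂ := hQP x hx v
    rw [hSa]
    simp only [ContinuousLinearMap.comp_apply, _root_.add_apply,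
      _root_.sub_apply, ContinuousLinearMap.id_apply] at *
    simp only [h₁, h₂]
    simp
  · have hz' := hT.adjoint_comp_mem z hz
    have h₁ := tt _ hz' v
    have h₂ := tt _ (hQ.adjoint_comp_mem _ hz') v
    have h₃ := hadd _ hz' v
    rw [hSa]
    simp only [ContinuousLinearMap.adjoint_comp, ContinuousLinearMap.comp_apply,
      _root_.add_apply,
      _root_.sub_apply, ContinuousLinearMap.id_apply, map_add, map_sub] at *
    simp only [h₁, h₂]
    have h₄ := congrArg T h₃
    rw [map_add] at h₄
    simp only [sub_self, zero_add]
    rw [← h₄]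
    abel_nf

/-- The Eilenberg swindle: if each of `𝒳`, `𝒵` splits as a sum of two copies of itself and embeds
isometrically into the other, then there is a unitary multiplier between them. -/
theorem IsIsometricMultiplier.exists_unitary {T : A →L[ℂ] B} {T' : B →L[ℂ] A}
    (hT : IsIsometricMultiplier 𝒳 𝒵 T) (hT' : IsIsometricMultiplier 𝒵 𝒳 T')
    {P Q : A →L[ℂ] A}
    (hP : IsIsometricMultiplier 𝒳 𝒳 P) (hQ : IsIsometricMultiplier 𝒳 𝒳 Q)
    (hPQ : ∀ x ∈ 𝒳, ∀ v, adjoint P (Q (x v)) = 0)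
    (hadd : ∀ x ∈ 𝒳, ∀ v, P (adjoint P (x v)) + Q (adjoint Q (x v)) = x v)
    {P' Q' : B →L[ℂ] B}
    (hP' : IsIsometricMultiplier 𝒵 𝒵 P') (hQ' : IsIsometricMultiplier 𝒵 𝒵 Q')
    (hPQ' : ∀ z ∈ 𝒵, ∀ v, adjoint P' (Q' (z v)) = 0)
    (hadd' : ∀ z ∈ 𝒵, ∀ v, P' (adjoint P' (z v)) + Q' (adjoint Q' (z v)) = z v) :
    ∃ U : B →L[ℂ] A, IsIsometricMultiplier 𝒵 𝒳 U ∧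
      IsIsometricMultiplier 𝒳 𝒵 (ContinuousLinearMap.adjoint U) := by
  obtain ⟨R, S, hR, hS, hRS, hSR, hRSadd⟩ := hT.exists_absorbing hP hQ hPQ hadd
  obtain ⟨R', S', hR', hS', hRS', hSR', hRSadd'⟩ := hT'.exists_absorbing hP' hQ' hPQ' hadd'
  -- `U` matches the two decompositions: it sends `R x` to `S' x` and `S z` to `R' z`.
  have hU : IsMultiplier 𝒵 𝒳 (S' ∘L adjoint R + R' ∘L adjoint S) :=
    (hS'.comp hR.adjoint).add (hR'.comp hS.adjoint)
  have hUa : adjoint (S' ∘L adjoint R + R' ∘L adjoint S) =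
      R ∘L adjoint S' + S ∘L adjoint R' := by
    simp [ContinuousLinearMap.adjoint_comp]
  refine ⟨_, ⟨hU, fun z hz v => ?_⟩, ⟨hU.adjoint, fun x hx v => ?_⟩⟩
  · have h₁ := hS'.adjoint_apply_apply _ (hR.adjoint_comp_mem z hz) v
    have h₂ := hR'.adjoint_apply_apply _ (hS.adjoint_comp_mem z hz) v
    have h₃ := hRS' _ (hR.adjoint_comp_mem z hz) v
    have h₄ := hSR' _ (hS.adjoint_comp_mem z hz) v
    rw [hUa]
    simp only [ContinuousLinearMap.comp_apply, _root_.add_apply, map_add] at *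
    simp only [h₁, h₂, h₃, h₄, map_zero, add_zero, zero_add]
    exact hRSadd z hz v
  · have h₁ := hS.adjoint_apply_apply _ (hR'.adjoint_comp_mem x hx) v
    have h₂ := hR.adjoint_apply_apply _ (hS'.adjoint_comp_mem x hx) v
    have h₃ := hRS _ (hR'.adjoint_comp_mem x hx) v
    have h₄ := hSR _ (hS'.adjoint_comp_mem x hx) v
    rw [ContinuousLinearMap.adjoint_adjoint, hUa]
    simp only [ContinuousLinearMap.comp_apply, _root_.add_apply, map_add] at *
    simp only [h₁, h₂, h₃, h₄, map_zero, add_zero, zero_add]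
    rw [add_comm]
    exact hRSadd' x hx v

end Multiplier

/-! ### Infinite ampliations of columns as isometric multipliers. -/

section Column

variable {E K H : Type*}
  [NormedAddCommGroup E] [InnerProductSpace ℂ E]
  [NormedAddCommGroup K] [InnerProductSpace ℂ K] [CompleteSpace K]
  [NormedAddCommGroup H] [InnerProductSpace ℂ H] [CompleteSpace H]

theorem sum_norm_sq_apply_eq (a : ℕ → (K →L[ℂ] H)) (k : ℕ) (v : K) :
    ∑ i ∈ Finset.range k, ‖a i v‖ ^ 2 =
      RCLike.re (inner ℂ ((∑ i ∈ Finset.range k, adjoint (a i) ∘L a i) v) v) := by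
  rw [_root_.sum_apply, sum_inner, map_sum]
  refine Finset.sum_congr rfl fun i _ => ?_
  rw [ContinuousLinearMap.comp_apply, ContinuousLinearMap.adjoint_inner_left,
    inner_self_eq_norm_sq]

/-- Within the fibre over `j` the second coordinate determines `p`, so the sum is dominated by a
partial sum of `‖a i v‖ ^ 2`, that is, by `⟨∑ (a i)* (a i) v, v⟩`. -/
theorem isColumnContraction_unpair {a : ℕ → (K →L[ℂ] H)}
    (ha : ∀ k, ‖∑ i ∈ Finset.range k, adjoint (a i) ∘L a i‖ ≤ 1) :
    IsColumnContraction (fun p => p.unpair.1) (fun p => a p.unpair.2) := by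
  intro j s hs v
  have hinj : Set.InjOn (fun p : ℕ => p.unpair.2) s := fun p hp q hq hpq => by
    rw [← Nat.pair_unpair p, ← Nat.pair_unpair q]
    congr 1
    exact (hs p hp).trans (hs q hq).symm
  obtain ⟨N, hN⟩ := (s.image fun p => p.unpair.2).exists_nat_subset_range
  calc ∑ p ∈ s, ‖a p.unpair.2 v‖ ^ 2
      = ∑ i ∈ s.image fun p => p.unpair.2, ‖a i v‖ ^ 2 := (Finset.sum_image (f := fun i => ‖a i v‖ ^ 2) hinj).symm
    _ ≤ ∑ i ∈ Finset.range N, ‖a i v‖ ^ 2 :=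
        Finset.sum_le_sum_of_subset_of_nonneg hN fun _ _ _ => by positivity
    _ ≤ ‖(∑ i ∈ Finset.range N, adjoint (a i) ∘L a i) v‖ * ‖v‖ := by
        rw [sum_norm_sq_apply_eq]
        exact re_inner_le_norm _ _
    _ ≤ 1 * ‖v‖ * ‖v‖ := by
        gcongr
        exact ContinuousLinearMap.le_of_opNorm_le _ (ha N) v
    _ = ‖v‖ ^ 2 := by ring

/-- The infinite ampliation `K^(∞) → H^(∞× ∞) ≅ H^(∞)` of the column `(a i)`. -/
noncomputable def columnAmpl (a : ℕ → (K →L[ℂ] H))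
    (ha : ∀ k, ‖∑ i ∈ Finset.range k, adjoint (a i) ∘L a i‖ ≤ 1) : Ampl K →L[ℂ] Ampl H :=
  rowMonomial _ _ (isColumnContraction_unpair ha)

variable {a : ℕ → (K →L[ℂ] H)}
  (ha : ∀ k, ‖∑ i ∈ Finset.range k, adjoint (a i) ∘L a i‖ ≤ 1)

theorem columnAmpl_inclusion_apply (j i : ℕ) (w : K) :
    columnAmpl a ha (inclusion K j w) (Nat.pair j i) = a i w := by
  rw [columnAmpl, rowMonomial_apply, inclusion_apply, Nat.unpair_pair, if_pos rfl]

/-- By Pythagoras the squared tail is the squared norm of the whole column minus the partial sum.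
The column is a contraction, so with `S k` the partial sum of `(a i)* (a i)` this is at most `‖w‖ ^
2 - ⟨S k w, w⟩`, and Cauchy–Schwarz applies. -/
theorem norm_sub_sum_columnAmpl_le (j k : ℕ) (w : K) :
    ‖columnAmpl a ha (inclusion K j w) -
        ∑ i ∈ Finset.range k, inclusion H (Nat.pair j i) (a i w)‖ ^ 2 ≤
      ‖w - (∑ i ∈ Finset.range k, adjoint (a i) ∘L a i) w‖ * ‖w‖ := by
  have hinj : Set.InjOn (Nat.pair j) (Finset.range k) := fun p _ q _ h => by
    simpa using congrArg (fun r => (Nat.unpair r).2) h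
  set ξ := columnAmpl a ha (inclusion K j w) with hξ
  have h := lp.norm_sub_norm_compl_sub_single (p := 2) (by simp) ξ
    ((Finset.range k).image (Nat.pair j))
  rw [Finset.sum_image hinj, Finset.sum_image hinj] at h
  simp only [hξ, columnAmpl_inclusion_apply] at h
  rw [← hξ] at h
  simp only [ENNReal.toReal_ofNat, Real.rpow_ofNat] at h
  rw [sum_norm_sq_apply_eq] at h
  have h₁ : ‖ξ‖ ≤ ‖w‖ := (norm_rowMonomial_apply_le _ _).trans_eq
    (lp.norm_single (by simp) _ _)
  have h₂ : ‖ξ‖ ^ 2 ≤ ‖w‖ ^ 2 := by gcongr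
  have h₃ := re_inner_le_norm (𝕜 := ℂ) (w - (∑ i ∈ Finset.range k, adjoint (a i) ∘L a i) w) w
  rw [inner_sub_left, map_sub, inner_self_eq_norm_sq] at h₃
  simp only [lp.singleContinuousLinearMap_apply]
  linarith

/-- The column itself need not converge in norm. After composition with `x` the tail estimate is
uniform over the unit ball, which makes the limit an element of `K_∞` rather than merely of `M_∞`.
-/
theorem tendsto_columnAmpl_comp_matrixUnit {x : E →L[ℂ] K}
    (hx : Tendsto (fun k => (∑ i ∈ Finset.range k, adjoint (a i) ∘L a i) ∘L x) atTop (𝓝 x))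
    (j l : ℕ) :
    Tendsto (fun k => ∑ i ∈ Finset.range k, matrixUnit (Nat.pair j i) l (a i ∘L x)) atTop
      (𝓝 (columnAmpl a ha ∘L matrixUnit j l x)) := by
  refine (tendsto_iff_norm_sub_tendsto_zero (E := Ampl E →L[ℂ] Ampl H)).2 ?_
  have hbound : Tendsto (fun k =>
      √(‖x - (∑ i ∈ Finset.range k, adjoint (a i) ∘L a i) ∘L x‖ * ‖x‖)) atTop (𝓝 0) := by
    have h := ((tendsto_const_nhds (x := x)).sub hx).norm.mul_const ‖x‖
    rw [sub_self, norm_zero, zero_mul] at h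
    simpa using h.sqrt
  refine squeeze_zero (fun _ => ContinuousLinearMap.opNorm_nonneg _) (fun k => ?_) hbound
  refine ContinuousLinearMap.opNorm_le_bound _ (Real.sqrt_nonneg _) fun v => ?_
  refine le_of_sq_le_sq ?_ (by positivity)
  have h := norm_sub_sum_columnAmpl_le ha j k (x (v l))
  have hv : ‖v l‖ ≤ ‖v‖ := lp.norm_apply_le_norm (by simp) v l
  rw [mul_pow, Real.sq_sqrt (by positivity)]
  calc _ = ‖columnAmpl a ha (inclusion K j (x (v l))) -
        ∑ i ∈ Finset.range k, inclusion H (Nat.pair j i) (a i (x (v l)))‖ ^ 2 := by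
        rw [_root_.sub_apply, _root_.sum_apply, norm_sub_rev]; rfl
    _ ≤ _ := h
    _ ≤ (‖x - (∑ i ∈ Finset.range k, adjoint (a i) ∘L a i) ∘L x‖ * ‖v‖) * (‖x‖ * ‖v‖) := by
        gcongr
        · exact ((x - (∑ i ∈ Finset.range k, adjoint (a i) ∘L a i) ∘L x).le_opNorm (v l)).trans
            (by gcongr)
        · exact (x.le_opNorm _).trans (by gcongr)
    _ = _ := by ring

theorem adjoint_columnAmpl_comp_matrixUnit (j i l : ℕ) (z : E →L[ℂ] H) :
    adjoint (columnAmpl a ha) ∘L matrixUnit (Nat.pair j i) l z =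
      matrixUnit j l (adjoint (a i) ∘L z) := by
  refine comp_matrixUnit _ _ _ _ _ _ ?_
  rw [columnAmpl, adjoint_rowMonomial_comp_inclusion, Nat.unpair_pair]

theorem isIsometricMultiplier_columnAmpl {X : Submodule ℂ (E →L[ℂ] K)}
    {Z : Submodule ℂ (E →L[ℂ] H)} (hXZ : ∀ i, ∀ x ∈ X, a i ∘L x ∈ Z)
    (hZX : ∀ i, ∀ z ∈ Z, adjoint (a i) ∘L z ∈ X)
    (hX : ∀ x ∈ X,
      Tendsto (fun k => (∑ i ∈ Finset.range k, adjoint (a i) ∘L a i) ∘L x) atTop (𝓝 x)) :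
    IsIsometricMultiplier (KInfty X) (KInfty Z) (columnAmpl a ha) where
  comp_mem x hx := comp_mem_KInfty (fun j l x hx =>
    (isClosed_KInfty Z).mem_of_tendsto (tendsto_columnAmpl_comp_matrixUnit ha (hX x hx) j l)
      (.of_forall fun k => Submodule.sum_mem _ fun i _ =>
        matrixUnit_mem_KInfty (hXZ i x hx) _ _)) hx
  adjoint_comp_mem z hz := comp_mem_KInfty (fun p l z hz => by
    rw [← Nat.pair_unpair p, adjoint_columnAmpl_comp_matrixUnit]
    exact matrixUnit_mem_KInfty (hZX _ z hz) _ _) hz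
  adjoint_apply_apply x hx v := by
    refine DFunLike.congr_fun (comp_eq_self_of_mem_KInfty (S := adjoint (columnAmpl a ha) ∘L
      columnAmpl a ha) (fun j l x hx => ?_) hx) v
    rw [ContinuousLinearMap.comp_assoc]
    -- The products of the adjoint with the finite truncations are matrix units with coefficient `S
    -- k x`, where `S k` is the partial sum of `(a i)* (a i)`. Their limit is computed in two ways.
    have h₁ := ((compL ℂ (Ampl E) _ _ (adjoint (columnAmpl a ha))).continuous.tendsto _).comp
      (tendsto_columnAmpl_comp_matrixUnit ha (hX x hx) j l)
    have h₂ : Tendsto (fun k => matrixUnit j l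
        ((∑ i ∈ Finset.range k, adjoint (a i) ∘L a i) ∘L x)) atTop (𝓝 (matrixUnit j l x)) :=
      (((compL ℂ (Ampl E) _ _ (inclusion K j)).continuous.comp
        ((compL ℂ (Ampl E) E K).flip (coord E l)).continuous).tendsto x).comp (hX x hx)
    refine tendsto_nhds_unique h₁ (h₂.congr fun k => ?_)
    simp only [Function.comp_apply, map_sum, ContinuousLinearMap.compL_apply,
      adjoint_columnAmpl_comp_matrixUnit]
    simp only [matrixUnit, ContinuousLinearMap.finsetSum_comp, ContinuousLinearMap.comp_finsetSum,
      ContinuousLinearMap.comp_assoc]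

theorem isIsometricMultiplier_spread (X : Submodule ℂ (E →L[ℂ] K)) {r : ℕ} (hr : r < 2) :
    IsIsometricMultiplier (KInfty X) (KInfty X) (spread K r) where
  comp_mem x hx := comp_mem_KInfty (fun j l x hx => by
    rw [comp_matrixUnit x (.id ℂ K) _ _ _ (2 * j + r) (spread_comp_inclusion hr j)]
    exact matrixUnit_mem_KInfty hx _ _) hx
  adjoint_comp_mem x hx := comp_mem_KInfty (fun p l x hx => by
    rw [matrixUnit, ← ContinuousLinearMap.comp_assoc, adjoint_spread_comp_inclusion]
    split_ifs
    · exact matrixUnit_mem_KInfty hx _ _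
    · rw [ContinuousLinearMap.zero_comp]; exact Submodule.zero_mem _) hx
  adjoint_apply_apply x _ v := adjoint_spread_apply_spread_self hr (x v)

/-- One-sided stabilization: if the sequences `m` and `n` move `X` and `Z` into each other
and their squares form approximate units, then a unitary multiplier identifies `K_∞(X)` and
`K_∞(Z)`. -/
theorem exists_unitary_multiplier {X : Submodule ℂ (E →L[ℂ] K)} {Z : Submodule ℂ (E →L[ℂ] H)}
    {m n : ℕ → (H →L[ℂ] K)}
    (hm_le : ∀ k, ‖∑ i ∈ Finset.range k, m i ∘L adjoint (m i)‖ ≤ 1)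
    (hn_le : ∀ k, ‖∑ i ∈ Finset.range k, adjoint (n i) ∘L n i‖ ≤ 1)
    (hm_lim : ∀ x ∈ X, Tendsto (fun k => (∑ i ∈ Finset.range k, m i ∘L adjoint (m i)) ∘L x)
      atTop (𝓝 x))
    (hn_lim : ∀ z ∈ Z, Tendsto (fun k => (∑ i ∈ Finset.range k, adjoint (n i) ∘L n i) ∘L z)
      atTop (𝓝 z))
    (hmZ : ∀ i, ∀ z ∈ Z, m i ∘L z ∈ X) (hmX : ∀ i, ∀ x ∈ X, adjoint (m i) ∘L x ∈ Z)
    (hnZ : ∀ i, ∀ z ∈ Z, n i ∘L z ∈ X) (hnX : ∀ i, ∀ x ∈ X, adjoint (n i) ∘L x ∈ Z) :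
    ∃ U : Ampl H →L[ℂ] Ampl K, IsIsometricMultiplier (KInfty Z) (KInfty X) U ∧
      IsIsometricMultiplier (KInfty X) (KInfty Z) (adjoint U) := by
  -- The column consists of the adjoints of the `m i`, so that its squares are `m i (m i)*`.
  have hW := isIsometricMultiplier_columnAmpl (X := X) (Z := Z) (a := fun i => adjoint (m i))
    (by simpa using hm_le) hmX (by simpa using hmZ) (by simpa using hm_lim)
  have hV := isIsometricMultiplier_columnAmpl (X := Z) (Z := X) (a := n) hn_le hnZ hnX hn_lim
  exact hW.exists_unitary hV
    (isIsometricMultiplier_spread X zero_lt_two) (isIsometricMultiplier_spread X one_lt_two)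
    (fun x _ v => adjoint_spread_apply_spread_of_ne one_lt_two one_ne_zero _)
    (fun x _ v => spread_apply_adjoint_spread_add _)
    (isIsometricMultiplier_spread Z zero_lt_two) (isIsometricMultiplier_spread Z one_lt_two)
    (fun x _ v => adjoint_spread_apply_spread_of_ne one_lt_two one_ne_zero _)
    (fun x _ v => spread_apply_adjoint_spread_add _)

end Column

/-! ### Complete isometries from unitary multipliers and from adjoints. -/

section CompleteIsometry

variable {E F E' F' E'' F'' : Type*}
  [NormedAddCommGroup E] [InnerProductSpace ℂ E]
  [NormedAddCommGroup F] [InnerProductSpace ℂ F]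
  [NormedAddCommGroup E'] [InnerProductSpace ℂ E']
  [NormedAddCommGroup F'] [InnerProductSpace ℂ F']
  [NormedAddCommGroup E''] [InnerProductSpace ℂ E'']
  [NormedAddCommGroup F''] [InnerProductSpace ℂ F'']

theorem CompletelyIsometricallyIsomorphic.trans {X : Submodule ℂ (E →L[ℂ] F)}
    {Y : Submodule ℂ (E' →L[ℂ] F')} {Z : Submodule ℂ (E'' →L[ℂ] F'')}
    (hXY : CompletelyIsometricallyIsomorphic X Y) (hYZ : CompletelyIsometricallyIsomorphic Y Z) :
    CompletelyIsometricallyIsomorphic X Z := by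
  obtain ⟨θ, hθ⟩ := hXY
  obtain ⟨η, hη⟩ := hYZ
  exact ⟨θ.trans η, fun n a => (hη n fun i j => θ (a i j)).trans (hθ n a)⟩

theorem matrixOp_apply {n : ℕ} (a : Fin n → Fin n → (E →L[ℂ] F))
    (v : PiLp 2 (fun _ : Fin n => E)) (i : Fin n) : matrixOp a v i = ∑ j, a i j (v j) := by
  simp [matrixOp]

theorem adjoint_matrixOp [CompleteSpace E] [CompleteSpace F] {n : ℕ}
    (a : Fin n → Fin n → (E →L[ℂ] F)) :
    adjoint (matrixOp a) = matrixOp fun i j => adjoint (a j i) := by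
  symm
  rw [ContinuousLinearMap.eq_adjoint_iff]
  intro v w
  simp only [PiLp.inner_apply, matrixOp_apply, sum_inner, inner_sum,
    ContinuousLinearMap.adjoint_inner_left]
  exact Finset.sum_comm

theorem norm_matrixOp_adjoint [CompleteSpace E] [CompleteSpace F] {n : ℕ}
    (a : Fin n → Fin n → (E →L[ℂ] F)) :
    ‖matrixOp fun i j => adjoint (a i j)‖ = ‖matrixOp fun i j => a j i‖ := by
  rw [← adjoint_matrixOp fun i j => a j i]
  exact LinearIsometryEquiv.norm_map _ _

theorem CompletelyIsometricallyIsomorphic.adjointSpace [CompleteSpace E] [CompleteSpace F]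
    [CompleteSpace E'] [CompleteSpace F'] {X : Submodule ℂ (E →L[ℂ] F)}
    {Y : Submodule ℂ (E' →L[ℂ] F')} (h : CompletelyIsometricallyIsomorphic X Y) :
    CompletelyIsometricallyIsomorphic (adjointSpace X) (adjointSpace Y) := by
  obtain ⟨θ, hθ⟩ := h
  -- `φ` is conjugate linear; taking the adjoint once more after `θ` restores linearity. On matrices
  -- each adjoint also transposes, and the two transpositions cancel.
  let φ : OperatorSpace.adjointSpace X → X := fun x => ⟨adjoint x.1, x.2⟩
  refine ⟨⟨⟨⟨fun x => ⟨adjoint (θ (φ x)).1, ?_⟩, fun x y => ?_⟩, fun c x => ?_⟩,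
    fun y => ⟨adjoint (θ.symm ⟨adjoint y.1, y.2⟩).1, ?_⟩, fun x => ?_, fun y => ?_⟩, fun n a => ?_⟩
  · simp [mem_adjointSpace]
  · have : φ (x + y) = φ x + φ y := Subtype.ext (map_add (adjoint (𝕜 := ℂ)) x.1 y.1)
    ext1
    simp [this]
  · have : φ (c • x) = (starRingEnd ℂ c) • φ x :=
      Subtype.ext (map_smulₛₗ (adjoint (𝕜 := ℂ)) c x.1)
    ext1
    simp [this, map_smulₛₗ]
  · simp [mem_adjointSpace]
  · simp [φ]
  · simp [φ]
  · change ‖matrixOp fun i j => adjoint (θ (φ (a i j))).1‖ = _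
    rw [norm_matrixOp_adjoint, hθ n fun i j => φ (a j i)]
    exact (norm_matrixOp_adjoint fun i j => (a j i).1)

/-- `U` is not assumed isometric on `F`, but `U* U` fixes each `x v`, hence their finite sums. The
rows of a matrix applied to a vector are such sums. -/
theorem IsIsometricMultiplier.norm_apply [CompleteSpace F] [CompleteSpace F']
    {𝒳 : Submodule ℂ (E →L[ℂ] F)} {𝒵 : Submodule ℂ (E →L[ℂ] F')} {U : F →L[ℂ] F'}
    (hU : IsIsometricMultiplier 𝒳 𝒵 U) {ι : Type*} (s : Finset ι) (x : ι → 𝒳) (v : ι → E) :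
    ‖U (∑ i ∈ s, (x i).1 (v i))‖ = ‖∑ i ∈ s, (x i).1 (v i)‖ := by
  have h : adjoint U (U (∑ i ∈ s, (x i).1 (v i))) = ∑ i ∈ s, (x i).1 (v i) := by
    simp only [map_sum]
    exact Finset.sum_congr rfl fun i _ => hU.adjoint_apply_apply _ (x i).2 _
  rw [← sq_eq_sq₀ (norm_nonneg _) (norm_nonneg _), ← inner_self_eq_norm_sq (𝕜 := ℂ),
    ← inner_self_eq_norm_sq (𝕜 := ℂ), ← ContinuousLinearMap.adjoint_inner_left, h]

/-- A unitary multiplier induces a completely isometric isomorphism. -/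
theorem IsIsometricMultiplier.completelyIsometricallyIsomorphic
    [CompleteSpace F] [CompleteSpace F']
    {𝒳 : Submodule ℂ (E →L[ℂ] F)} {𝒵 : Submodule ℂ (E →L[ℂ] F')} {U : F →L[ℂ] F'}
    (hU : IsIsometricMultiplier 𝒳 𝒵 U) (hU' : IsIsometricMultiplier 𝒵 𝒳 (adjoint U)) :
    CompletelyIsometricallyIsomorphic 𝒳 𝒵 := by
  refine ⟨⟨⟨⟨fun x => ⟨U ∘L x.1, hU.comp_mem _ x.2⟩, fun x y => ?_⟩, fun c x => ?_⟩,
    fun z => ⟨adjoint U ∘L z.1, hU.adjoint_comp_mem _ z.2⟩, fun x => ?_, fun z => ?_⟩, fun n a => ?_⟩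
  · ext1
    exact ContinuousLinearMap.comp_add _ _ _
  · ext1
    exact ContinuousLinearMap.comp_smul _ _ _
  · ext1
    ext v
    exact hU.adjoint_apply_apply _ x.2 v
  · ext1
    ext v
    have := hU'.adjoint_apply_apply _ z.2 v
    rwa [ContinuousLinearMap.adjoint_adjoint] at this
  · refine ContinuousLinearMap.opNorm_ext _ _ fun v => ?_
    rw [← sq_eq_sq₀ (norm_nonneg _) (norm_nonneg _), PiLp.norm_sq_eq_of_L2, PiLp.norm_sq_eq_of_L2]
    refine Finset.sum_congr rfl fun i _ => ?_
    rw [matrixOp_apply, matrixOp_apply, ← hU.norm_apply, map_sum]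
    rfl

end CompleteIsometry

/-! ### Approximate units given by contractions. -/

section ApproximateUnit

variable {V : Type*} [NormedAddCommGroup V] [NormedSpace ℂ V]

/-- The vectors `v` with `L k v → v`. -/
def approxFixed (L : ℕ → V →L[ℂ] V) : Submodule ℂ V where
  carrier := {v | Tendsto (fun k => L k v) atTop (𝓝 v)}
  zero_mem' := by simp
  add_mem' := fun {v w} hv hw => by
    simp only [Set.mem_ofPred_eq, map_add] at *
    exact hv.add hw
  smul_mem' := fun c v hv => by
    simp only [Set.mem_ofPred_eq, map_smul] at *
    exact hv.const_smul c

theorem mem_approxFixed {L : ℕ → V →L[ℂ] V} {v : V} :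
    v ∈ approxFixed L ↔ Tendsto (fun k => L k v) atTop (𝓝 v) := Iff.rfl

theorem isClosed_approxFixed {L : ℕ → V →L[ℂ] V} (hL : ∀ k, ‖L k‖ ≤ 1) :
    IsClosed (approxFixed L : Set V) := by
  refine isClosed_of_closure_subset fun v hv => ?_
  refine Metric.tendsto_atTop.2 fun ε hε => ?_
  obtain ⟨w, hw, hvw⟩ := Metric.mem_closure_iff.1 hv (ε / 3) (by positivity)
  obtain ⟨N, hN⟩ := Metric.tendsto_atTop.1 (mem_approxFixed.1 hw) (ε / 3) (by positivity)
  refine ⟨N, fun k hk => ?_⟩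
  have h₁ := hN k hk
  have h₂ : dist (L k v) (L k w) ≤ dist v w := by
    rw [dist_eq_norm, dist_eq_norm, ← map_sub]
    simpa using (L k).le_of_opNorm_le (hL k) (v - w)
  have h₃ := dist_triangle4_right (L k v) v (L k w) w
  linarith

end ApproximateUnit

/-! ### The linking space of a strong TRO equivalence. -/

section TRO

variable {K₁ K₂ H₁ H₂ : Type*}
  [NormedAddCommGroup K₁] [InnerProductSpace ℂ K₁] [CompleteSpace K₁]
  [NormedAddCommGroup K₂] [InnerProductSpace ℂ K₂] [CompleteSpace K₂]
  [NormedAddCommGroup H₁] [InnerProductSpace ℂ H₁] [CompleteSpace H₁]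
  [NormedAddCommGroup H₂] [InnerProductSpace ℂ H₂] [CompleteSpace H₂]
  {X : Submodule ℂ (K₁ →L[ℂ] K₂)} {Y : Submodule ℂ (H₁ →L[ℂ] H₂)}
  {M₁ : Submodule ℂ (H₁ →L[ℂ] K₁)} {M₂ : Submodule ℂ (H₂ →L[ℂ] K₂)}

namespace StronglyTROEquivalentVia

theorem mul_mul_adjoint_mem (h : StronglyTROEquivalentVia X Y M₁ M₂)
    {m y n} (hm : m ∈ M₂) (hy : y ∈ Y) (hn : n ∈ M₁) :
    m ∘L y ∘L adjoint n ∈ X := by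
  rw [h.left_eq]
  exact Submodule.le_topologicalClosure _ (Submodule.subset_span ⟨m, hm, y, hy, n, hn, rfl⟩)

theorem adjoint_mul_mul_mem (h : StronglyTROEquivalentVia X Y M₁ M₂)
    {m x n} (hm : m ∈ M₂) (hx : x ∈ X) (hn : n ∈ M₁) :
    adjoint m ∘L x ∘L n ∈ Y := by
  rw [h.right_eq]
  exact Submodule.le_topologicalClosure _ (Submodule.subset_span ⟨m, hm, x, hx, n, hn, rfl⟩)

/-- On a generator `a y b*` of `X` the product is `(m m'* a) y b*`, and `m m'* a` lies in `M₂` by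
the TRO property. Closedness of `X` does the rest. -/
theorem mul_adjoint_mul_mem_left (h : StronglyTROEquivalentVia X Y M₁ M₂)
    (hX : IsOperatorSpace X) {m m' x} (hm : m ∈ M₂) (hm' : m' ∈ M₂)
    (hx : x ∈ X) : m ∘L adjoint m' ∘L x ∈ X := by
  rw [← ContinuousLinearMap.comp_assoc]
  suffices X ≤ X.comap (compL ℂ K₁ K₂ K₂ (m ∘L adjoint m')).toLinearMap from this hx
  conv_lhs => rw [h.left_eq]
  refine Submodule.topologicalClosure_minimal _ (Submodule.span_le.2 ?_)
    (hX.preimage (compL ℂ K₁ K₂ K₂ (m ∘L adjoint m')).continuous)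
  rintro _ ⟨a, ha, y, hy, b, hb, rfl⟩
  have := h.mul_mul_adjoint_mem (h.isTRO_snd.mul_adjoint_mul_mem m hm m' hm' a ha) hy hb
  change (m ∘L adjoint m') ∘L a ∘L y ∘L adjoint b ∈ X
  simpa only [ContinuousLinearMap.comp_assoc] using this

theorem mul_adjoint_mul_mem_right (h : StronglyTROEquivalentVia X Y M₁ M₂)
    (hY : IsOperatorSpace Y) {y n n'} (hy : y ∈ Y) (hn : n ∈ M₁)
    (hn' : n' ∈ M₁) : y ∘L adjoint n ∘L n' ∈ Y := by
  suffices Y ≤ Y.comap ((compL ℂ H₁ H₁ H₂).flip (adjoint n ∘L n')).toLinearMap from this hy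
  conv_lhs => rw [h.right_eq]
  refine Submodule.topologicalClosure_minimal _ (Submodule.span_le.2 ?_)
    (hY.preimage ((compL ℂ H₁ H₁ H₂).flip (adjoint n ∘L n')).continuous)
  rintro _ ⟨a, ha, x, hx, b, hb, rfl⟩
  have := h.adjoint_mul_mul_mem ha hx (h.isTRO_fst.mul_adjoint_mul_mem b hb n hn n' hn')
  change (adjoint a ∘L x ∘L b) ∘L adjoint n ∘L n' ∈ Y
  simpa only [ContinuousLinearMap.comp_assoc] using this

end StronglyTROEquivalentVia

/-- The space of the `z : K₁ → H₂` with `M₂ z ⊆ X` and `z M₁ ⊆ Y`, on which the sums `N k` and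
`P k` act as approximate units from the left and from the right. It contains `M₂* X` and `Y M₁*`
when `X` and `Y` are strongly TRO equivalent. -/
def linkingSpace (X : Submodule ℂ (K₁ →L[ℂ] K₂)) (Y : Submodule ℂ (H₁ →L[ℂ] H₂))
    (M₁ : Submodule ℂ (H₁ →L[ℂ] K₁)) (M₂ : Submodule ℂ (H₂ →L[ℂ] K₂))
    (N : ℕ → H₂ →L[ℂ] H₂) (P : ℕ → K₁ →L[ℂ] K₁) : Submodule ℂ (K₁ →L[ℂ] H₂) where
  carrier := {z | (∀ m ∈ M₂, m ∘L z ∈ X) ∧ (∀ n ∈ M₁, z ∘L n ∈ Y) ∧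
    Tendsto (fun k => N k ∘L z) atTop (𝓝 z) ∧ Tendsto (fun k => z ∘L P k) atTop (𝓝 z)}
  zero_mem' := by simp
  add_mem' := by
    rintro z w ⟨hz₁, hz₂, hz₃, hz₄⟩ ⟨hw₁, hw₂, hw₃, hw₄⟩
    simp only [Set.mem_ofPred_eq, ContinuousLinearMap.comp_add, ContinuousLinearMap.add_comp]
    exact ⟨fun m hm => X.add_mem (hz₁ m hm) (hw₁ m hm),
      fun n hn => Y.add_mem (hz₂ n hn) (hw₂ n hn), hz₃.add hw₃, hz₄.add hw₄⟩
  smul_mem' := by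
    rintro c z ⟨hz₁, hz₂, hz₃, hz₄⟩
    simp only [Set.mem_ofPred_eq, ContinuousLinearMap.comp_smul, ContinuousLinearMap.smul_comp]
    exact ⟨fun m hm => X.smul_mem c (hz₁ m hm),
      fun n hn => Y.smul_mem c (hz₂ n hn), hz₃.const_smul c, hz₄.const_smul c⟩

/-- The delicate point is the left approximate unit, known only on `Y`. Each `m* x (e i)` lies in
`Y`, so `N k` converges to the identity on `m* x (e i) (e i)*`. Finite sums of these tend to `m* x`,
and `isClosed_approxFixed` passes to the limit. -/
theorem adjoint_comp_mem_linkingSpace (h : StronglyTROEquivalentVia X Y M₁ M₂)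
    (hX : IsOperatorSpace X) {N : ℕ → H₂ →L[ℂ] H₂} (hN_le : ∀ k, ‖N k‖ ≤ 1)
    (hN : ∀ y ∈ Y, Tendsto (fun k => N k ∘L y) atTop (𝓝 y))
    {e : ℕ → (H₁ →L[ℂ] K₁)} (he : ∀ i, e i ∈ M₁)
    (he_lim : ∀ x ∈ X, Tendsto (fun k => x ∘L (∑ i ∈ Finset.range k, e i ∘L adjoint (e i)))
      atTop (𝓝 x)) {m x} (hm : m ∈ M₂) (hx : x ∈ X) :
    adjoint m ∘L x ∈ linkingSpace X Y M₁ M₂ N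
      (fun k => ∑ i ∈ Finset.range k, e i ∘L adjoint (e i)) := by
  have hlim : Tendsto (fun k => (adjoint m ∘L x) ∘L
      ∑ i ∈ Finset.range k, e i ∘L adjoint (e i)) atTop (𝓝 (adjoint m ∘L x)) := by
    simp only [ContinuousLinearMap.comp_assoc]
    exact ((compL ℂ K₁ K₂ H₂ (adjoint m)).continuous.tendsto x).comp (he_lim x hx)
  refine ⟨fun a ha => h.mul_adjoint_mul_mem_left hX ha hm hx,
    fun n hn => by
      rw [ContinuousLinearMap.comp_assoc]; exact h.adjoint_mul_mul_mem hm hx hn, ?_, hlim⟩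
  refine (isClosed_approxFixed (L := fun k => compL ℂ K₁ H₂ H₂ (N k)) fun k => ?_).mem_of_tendsto
    hlim (.of_forall fun k => ?_)
  · refine ContinuousLinearMap.opNorm_le_bound _ zero_le_one fun z => ?_
    exact (ContinuousLinearMap.opNorm_comp_le _ _).trans (by gcongr; exact hN_le k)
  · rw [ContinuousLinearMap.comp_finsetSum]
    refine Submodule.sum_mem _ fun i _ => ?_
    have := (((compL ℂ K₁ H₁ H₂).flip (adjoint (e i))).continuous.tendsto _).comp
      (hN _ (h.adjoint_mul_mul_mem hm hx (he i)))
    simpa only [mem_approxFixed, Function.comp_def, ContinuousLinearMap.flip_apply,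
      ContinuousLinearMap.compL_apply, ContinuousLinearMap.comp_assoc] using this

/-- Mirror image: `y b*` is approximated from the left by sums of `(n i)* (n i) y b*`, where `(n i)
y b*` lies in `X` and the right approximate unit is known. -/
theorem comp_adjoint_mem_linkingSpace (h : StronglyTROEquivalentVia X Y M₁ M₂)
    (hY : IsOperatorSpace Y) {P : ℕ → K₁ →L[ℂ] K₁} (hP_le : ∀ k, ‖P k‖ ≤ 1)
    (hP : ∀ x ∈ X, Tendsto (fun k => x ∘L P k) atTop (𝓝 x))
    {n : ℕ → (H₂ →L[ℂ] K₂)} (hn : ∀ i, n i ∈ M₂)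
    (hn_lim : ∀ y ∈ Y, Tendsto (fun k => (∑ i ∈ Finset.range k, adjoint (n i) ∘L n i) ∘L y)
      atTop (𝓝 y)) {y b} (hy : y ∈ Y) (hb : b ∈ M₁) :
    y ∘L adjoint b ∈ linkingSpace X Y M₁ M₂
      (fun k => ∑ i ∈ Finset.range k, adjoint (n i) ∘L n i) P := by
  have hlim : Tendsto (fun k => (∑ i ∈ Finset.range k, adjoint (n i) ∘L n i) ∘L
      (y ∘L adjoint b)) atTop (𝓝 (y ∘L adjoint b)) := by
    simp only [← ContinuousLinearMap.comp_assoc]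
    exact (((compL ℂ K₁ H₁ H₂).flip (adjoint b)).continuous.tendsto y).comp (hn_lim y hy)
  refine ⟨fun a ha => h.mul_mul_adjoint_mem ha hy hb,
    fun n hn => by
      rw [ContinuousLinearMap.comp_assoc]; exact h.mul_adjoint_mul_mem_right hY hy hb hn, hlim, ?_⟩
  refine (isClosed_approxFixed (L := fun k => (compL ℂ K₁ K₁ H₂).flip (P k))
    fun k => ?_).mem_of_tendsto hlim (.of_forall fun k => ?_)
  · refine ContinuousLinearMap.opNorm_le_bound _ zero_le_one fun z => ?_
    refine (ContinuousLinearMap.opNorm_comp_le _ _).trans ?_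
    rw [mul_comm]
    gcongr
    exact hP_le k
  · rw [ContinuousLinearMap.finsetSum_comp]
    refine Submodule.sum_mem _ fun i _ => ?_
    have := ((compL ℂ K₁ K₂ H₂ (adjoint (n i))).continuous.tendsto _).comp
      (hP _ (h.mul_mul_adjoint_mem (hn i) hy hb))
    simpa only [mem_approxFixed, Function.comp_def, ContinuousLinearMap.flip_apply,
      ContinuousLinearMap.compL_apply, ContinuousLinearMap.comp_assoc] using this

end TRO

theorem tendsto_comp_of_tendsto_adjoint_comp {E F : Type*}
    [NormedAddCommGroup E] [InnerProductSpace ℂ E] [CompleteSpace E]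
    [NormedAddCommGroup F] [InnerProductSpace ℂ F] [CompleteSpace F]
    {P : ℕ → F →L[ℂ] F} (hP : ∀ k, adjoint (P k) = P k) {x : E →L[ℂ] F}
    (hx : Tendsto (fun k => adjoint x ∘L P k) atTop (𝓝 (adjoint x))) :
    Tendsto (fun k => P k ∘L x) atTop (𝓝 x) := by
  have h := ((adjoint (𝕜 := ℂ) (E := F) (F := E)).continuous.tendsto (adjoint x)).comp hx
  simpa [Function.comp_def, ContinuousLinearMap.adjoint_comp, hP] using h

end OperatorSpace

/-! ### Assembly through the linking space. -/

theorem theorem4p6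
    {K₁ K₂ H₁ H₂ : Type*}
    [NormedAddCommGroup K₁] [InnerProductSpace ℂ K₁] [CompleteSpace K₁]
    [NormedAddCommGroup K₂] [InnerProductSpace ℂ K₂] [CompleteSpace K₂]
    [NormedAddCommGroup H₁] [InnerProductSpace ℂ H₁] [CompleteSpace H₁]
    [NormedAddCommGroup H₂] [InnerProductSpace ℂ H₂] [CompleteSpace H₂]
    (X : Submodule ℂ (K₁ →L[ℂ] K₂)) (Y : Submodule ℂ (H₁ →L[ℂ] H₂))
    (hX : OperatorSpace.IsOperatorSpace X) (hY : OperatorSpace.IsOperatorSpace Y)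
    (M₁ : Submodule ℂ (H₁ →L[ℂ] K₁)) (M₂ : Submodule ℂ (H₂ →L[ℂ] K₂))
    (hXY : OperatorSpace.StronglyTROEquivalentVia X Y M₁ M₂)
    (m n : ℕ → (H₂ →L[ℂ] K₂)) (hm : ∀ i, m i ∈ M₂) (hn : ∀ i, n i ∈ M₂)
    (hm_le : ∀ k, ‖∑ i ∈ Finset.range k, m i ∘L adjoint (m i)‖ ≤ 1)
    (hn_le : ∀ k, ‖∑ i ∈ Finset.range k, adjoint (n i) ∘L n i‖ ≤ 1)
    (hm_lim : ∀ x ∈ X, Tendsto (fun k => (∑ i ∈ Finset.range k, m i ∘L adjoint (m i)) ∘L x)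
      atTop (𝓝 x))
    (hn_lim : ∀ y ∈ Y, Tendsto (fun k => (∑ i ∈ Finset.range k, adjoint (n i) ∘L n i) ∘L y)
      atTop (𝓝 y))
    (e f : ℕ → (H₁ →L[ℂ] K₁)) (he : ∀ i, e i ∈ M₁) (hf : ∀ i, f i ∈ M₁)
    (he_le : ∀ k, ‖∑ i ∈ Finset.range k, e i ∘L adjoint (e i)‖ ≤ 1)
    (hf_le : ∀ k, ‖∑ i ∈ Finset.range k, adjoint (f i) ∘L f i‖ ≤ 1)
    (he_lim : ∀ x ∈ X, Tendsto (fun k => x ∘L (∑ i ∈ Finset.range k, e i ∘L adjoint (e i)))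
      atTop (𝓝 x))
    (hf_lim : ∀ y ∈ Y, Tendsto (fun k => y ∘L (∑ i ∈ Finset.range k, adjoint (f i) ∘L f i))
      atTop (𝓝 y)) :
    OperatorSpace.StablyIsomorphic X Y := by
  let Z := OperatorSpace.linkingSpace X Y M₁ M₂
    (fun k => ∑ i ∈ Finset.range k, adjoint (n i) ∘L n i)
    (fun k => ∑ i ∈ Finset.range k, e i ∘L adjoint (e i))
  have hXZ : ∀ m ∈ M₂, ∀ x ∈ X, adjoint m ∘L x ∈ Z := fun m hm x hx =>
    OperatorSpace.adjoint_comp_mem_linkingSpace hXY hX hn_le hn_lim he he_lim hm hx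
  have hYZ : ∀ b ∈ M₁, ∀ y ∈ Y, y ∘L adjoint b ∈ Z := fun b hb y hy =>
    OperatorSpace.comp_adjoint_mem_linkingSpace hXY hY he_le he_lim hn hn_lim hy hb
  have hsa : ∀ k, adjoint (∑ i ∈ Finset.range k, e i ∘L adjoint (e i)) =
      ∑ i ∈ Finset.range k, e i ∘L adjoint (e i) := fun k => by
    simp [ContinuousLinearMap.adjoint_comp]
  have hsa' : ∀ k, adjoint (∑ i ∈ Finset.range k, adjoint (f i) ∘L f i) =
      ∑ i ∈ Finset.range k, adjoint (f i) ∘L f i := fun k => by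
    simp [ContinuousLinearMap.adjoint_comp]
  obtain ⟨U₂, hU₂, hU₂'⟩ := OperatorSpace.exists_unitary_multiplier (X := X) (Z := Z) hm_le hn_le
    hm_lim (fun z hz => hz.2.2.1) (fun i z hz => hz.1 _ (hm i)) (fun i => hXZ _ (hm i))
    (fun i z hz => hz.1 _ (hn i)) (fun i => hXZ _ (hn i))
  have hmemZ : ∀ b ∈ M₁, ∀ y ∈ OperatorSpace.adjointSpace Y,
      b ∘L y ∈ OperatorSpace.adjointSpace Z := fun b hb y hy => by
    rw [OperatorSpace.mem_adjointSpace, ContinuousLinearMap.adjoint_comp]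
    exact hYZ b hb _ hy
  have hmemY : ∀ b ∈ M₁, ∀ z ∈ OperatorSpace.adjointSpace Z,
      adjoint b ∘L z ∈ OperatorSpace.adjointSpace Y := fun b hb z hz => by
    rw [OperatorSpace.mem_adjointSpace, ContinuousLinearMap.adjoint_comp,
      ContinuousLinearMap.adjoint_adjoint]
    exact hz.2.1 b hb
  -- Right multiplication between `Z` and `Y` becomes left multiplication between their adjoint
  -- spaces. The partial sums are self-adjoint, so the right-hand limits turn into left-hand ones.
  obtain ⟨U₁, hU₁, hU₁'⟩ := OperatorSpace.exists_unitary_multiplier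
    (X := OperatorSpace.adjointSpace Z) (Z := OperatorSpace.adjointSpace Y) he_le hf_le
    (fun z hz => OperatorSpace.tendsto_comp_of_tendsto_adjoint_comp hsa hz.2.2.2)
    (fun y hy => OperatorSpace.tendsto_comp_of_tendsto_adjoint_comp hsa' (hf_lim _ hy))
    (fun i => hmemZ _ (he i)) (fun i => hmemY _ (he i))
    (fun i => hmemZ _ (hf i)) (fun i => hmemY _ (hf i))
  have h₁ := hU₂'.completelyIsometricallyIsomorphic (by simpa using hU₂)
  have h₂ := (hU₁'.completelyIsometricallyIsomorphic (by simpa using hU₁)).adjointSpace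
  rw [OperatorSpace.adjointSpace_KInfty_adjointSpace,
    OperatorSpace.adjointSpace_KInfty_adjointSpace] at h₂
  exact h₁.trans h₂
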